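/- Fix a reference orthonormal basis $\{|i\rangle\}$ of a finite-dimensional complex Hilbert space; the transpose $\cdot^T$, the complex conjugate $|\psi^*\rangle$ and the word "real" (all matrix elements are real) refer to this basis. For a pure state (unit vector) $|\psi\rangle$ let $$\mathscr I_g(|\psi\rangle)=1-\max_{|\phi\rangle}|\langle\phi|\psi\rangle|^2,$$ the maximum being over all unit vectors $|\phi\rangle$ for which $|\phi\rangle\langle\phi|$ is real. For a quantum state $\rho$ (positive semidefinite, trace one) let $$\mathscr I_g(\rho)=\min\sum_j p_j\,\mathscr I_g(|\psi_j\rangle),$$ the minimum being over all finite pure-state decompositions $\rho=\sum_j p_j|\psi_j\rangle\langle\psi_j|$ with $p_j\ge 0$, $\sum_j p_j=1$ and unit vectors $|\psi_j\rangle$. Let $\sqrt{F(\rho,\sigma)}=\operatorname{tr}\sqrt{\sqrt\rho\,\sigma\sqrt\rho}$. **Theorem.** For every quantum state $\rho$ on a space of dimension $d$, the minimum defining $\mathscr I_g(\rho)$ is attained and $$\mathscr I_g(\rho)=\frac{1-\sqrt{F(\rho,\rho^T)}}{2}.$$ Moreover, the minimum is attained by a conjugate-orthogonal decomposition: there is a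 pure-state decomposition $\rho=\sum_{j=1}^d\lambda_j|\mu_j\rangle\langle\mu_j|$ with $\sqrt{\lambda_i\lambda_j}\,\langle\mu_i|\mu_j^*\rangle=\delta_{ij}D_j$ for all $i,j$, where $D_1,\dots,D_d$ are the eigenvalues (with multiplicity) of $\sqrt{\sqrt\rho\,\rho^T\sqrt\rho}$, and $\sum_j\lambda_j\,\mathscr I_g(|\mu_j\rangle)=\mathscr I_g(\rho)$. -/

import Mathlib

open scoped ComplexOrder MatrixOrder Matrix

noncomputable section

namespace Imaginarity

variable {n : Type*} [Fintype n] [DecidableEq n]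

/-- A (mixed) quantum state: a positive semidefinite matrix of unit trace. Matrices and vectors
are written in the fixed reference basis, which is indexed by the finite type `n`. -/
structure IsState (ρ : Matrix n n ℂ) : Prop where
  posSemidef : ρ.PosSemidef
  trace_eq_one : ρ.trace = 1

/-- The operator `|ψ⟩⟨ψ|`. -/
def ketbra (ψ : EuclideanSpace ℂ n) : Matrix n n ℂ :=
  Matrix.of fun i j => ψ i * star (ψ j)

/-- A real operator: all its matrix elements in the reference basis are real. -/
def IsReal (A : Matrix n n ℂ) : Prop :=
  ∀ i j, (A i j).im = 0

/-- The entrywise complex conjugate `|ψ*⟩` of `|ψ⟩` in the reference basis. -/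
def conjVec (ψ : EuclideanSpace ℂ n) : EuclideanSpace ℂ n :=
  WithLp.toLp 2 fun i => star (ψ i)

/-- The overlaps `|⟨φ|ψ⟩|²` of `|ψ⟩` with all real pure states `|φ⟩`. -/
def realOverlaps (ψ : EuclideanSpace ℂ n) : Set ℝ :=
  {x | ∃ φ : EuclideanSpace ℂ n, ‖φ‖ = 1 ∧ IsReal (ketbra φ) ∧ x = ‖inner ℂ φ ψ‖ ^ 2}

/-- The geometric imaginarity of a pure state. The supremum is a maximum
(`realOverlaps_isGreatest`). -/
def pureGeomImaginarity (ψ : EuclideanSpace ℂ n) : ℝ :=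
  1 - sSup (realOverlaps ψ)

/-- `{p_j, |ψ_j⟩}` is a decomposition of `ρ` into pure states. -/
structure IsPureDecomposition {ι : Type*} [Fintype ι] (ρ : Matrix n n ℂ) (p : ι → ℝ)
    (ψ : ι → EuclideanSpace ℂ n) : Prop where
  nonneg : ∀ j, 0 ≤ p j
  sum_eq_one : ∑ j, p j = 1
  norm_eq_one : ∀ j, ‖ψ j‖ = 1
  eq_sum : ρ = ∑ j, (p j : ℂ) • ketbra (ψ j)

/-- The average imaginarities of all finite pure-state decompositions of `ρ`. -/
def averageImaginarities (ρ : Matrix n n ℂ) : Set ℝ :=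
  {x | ∃ (m : ℕ) (p : Fin m → ℝ) (ψ : Fin m → EuclideanSpace ℂ n),
    IsPureDecomposition ρ p ψ ∧ x = ∑ j, p j * pureGeomImaginarity (ψ j)}

/-- The geometric measure of imaginarity of a mixed state, as a convex roof. -/
def geomImaginarity (ρ : Matrix n n ℂ) : ℝ :=
  sInf (averageImaginarities ρ)

/-- The operator `√(√ρ σ √ρ)`. -/
def fidelityOp (ρ σ : Matrix n n ℂ) : Matrix n n ℂ :=
  CFC.sqrt (CFC.sqrt ρ * σ * CFC.sqrt ρ)

/-- The fidelity `F(ρ, σ) = (tr √(√ρ σ √ρ))²`. -/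
def fidelity (ρ σ : Matrix n n ℂ) : ℝ :=
  (fidelityOp ρ σ).trace.re ^ 2

theorem fidelityOp_posSemidef (ρ σ : Matrix n n ℂ) : (fidelityOp ρ σ).PosSemidef :=
  Matrix.nonneg_iff_posSemidef.mp (CFC.sqrt_nonneg _)

theorem fidelityOp_isHermitian (ρ σ : Matrix n n ℂ) : (fidelityOp ρ σ).IsHermitian :=
  (fidelityOp_posSemidef ρ σ).isHermitian

/-- The maximum in the geometric imaginarity of a pure state exists. -/
theorem realOverlaps_isGreatest [Nonempty n] (ψ : EuclideanSpace ℂ n) :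
    IsGreatest (realOverlaps ψ) (sSup (realOverlaps ψ)) := by
  have hS : IsCompact {φ : EuclideanSpace ℂ n | ‖φ‖ = 1 ∧ IsReal (ketbra φ)} := by
    have h1 : IsCompact (Metric.sphere (0 : EuclideanSpace ℂ n) 1) := isCompact_sphere 0 1
    have h2 : IsClosed {φ : EuclideanSpace ℂ n | IsReal (ketbra φ)} := by
      simp only [IsReal, ketbra, Matrix.of_apply, Set.ofPred_forall]
      refine isClosed_iInter fun i => isClosed_iInter fun j => ?_
      exact isClosed_eq (by fun_prop) continuous_const
    convert h1.inter_right h2 using 1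
    ext φ
    simp
  have himg : realOverlaps ψ = (fun φ : EuclideanSpace ℂ n => ‖inner ℂ φ ψ‖ ^ 2) ''
      {φ | ‖φ‖ = 1 ∧ IsReal (ketbra φ)} := by
    ext x
    constructor
    · rintro ⟨φ, h1, h2, rfl⟩
      exact ⟨φ, ⟨h1, h2⟩, rfl⟩
    · rintro ⟨φ, ⟨h1, h2⟩, rfl⟩
      exact ⟨φ, h1, h2, rfl⟩
  have hc : IsCompact (realOverlaps ψ) := by
    rw [himg]
    exact hS.image (by fun_prop)
  have hne : (realOverlaps ψ).Nonempty := by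
    obtain ⟨k⟩ := ‹Nonempty n›
    refine ⟨_, EuclideanSpace.single k 1, by simp, fun i j => ?_, rfl⟩
    by_cases hi : i = k <;> by_cases hj : j = k <;> simp [ketbra, hi, hj]
  exact hc.isGreatest_sSup hne

end Imaginarity

end

open scoped ComplexOrder MatrixOrder Matrix

namespace Imaginarity

variable {n : Type*} [Fintype n]

/-! For a unit vector the imaginarity is `(1 - |ψ ⬝ᵥ ψ|) / 2`, with `⬝ᵥ` bilinear
(`pureGeomImaginarity_eq`). Decompositions of `ρ` give factors `X * Xᴴ = ρ` with columns `√p_j ψ_j`,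
so the task is to maximize the sum of `|(Xᵀ * X) j j|`.

Put `R = √ρ`. The symmetric matrix `K = Rᵀ * R` has Takagi form `Uᵀ * K * U = D`, and `Kᴴ * K = R *
ρᵀ * R`, so `D` lists the eigenvalues of the fidelity operator. Every factor is `X = R * U * V` with
`V * Vᴴ ≤ 1`, hence `Xᵀ * X = Vᵀ * D * V`, and the sum is at most `tr D = √F`
(`sum_norm_diag_transpose_mul_self_le`). The factor `R * U` attains the bound, and its columns are
conjugate-orthogonal. -/

/-! ### Pure states and factors of `ρ` -/

theorem inner_conjVec_left (χ ψ : EuclideanSpace ℂ n) :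
    inner ℂ (conjVec χ) ψ = χ ⬝ᵥ ψ := by
  simp [conjVec, PiLp.inner_apply, dotProduct, mul_comm]

theorem norm_conjVec (χ : EuclideanSpace ℂ n) : ‖conjVec χ‖ = ‖χ‖ := by
  simp [conjVec, EuclideanSpace.norm_eq]

theorem norm_dotProduct_self_le (χ : EuclideanSpace ℂ n) : ‖χ ⬝ᵥ χ‖ ≤ ‖χ‖ ^ 2 := by
  have := norm_inner_le_norm (𝕜 := ℂ) (conjVec χ) χ
  rwa [inner_conjVec_left, norm_conjVec, ← sq] at this

/-- A real projector forces `φ = s φ*` with `|s| = 1`. With `z = ⟨φ|ψ⟩`, the residual `ψ - zφ` has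
squared norm `1 - |z|²` and bilinear square `ψ ⬝ᵥ ψ - s z²`; the former bounds the modulus of the
latter. -/
theorem norm_inner_sq_le_of_isReal (φ ψ : EuclideanSpace ℂ n) (hφ : ‖φ‖ = 1)
    (hr : IsReal (ketbra φ)) (hψ : ‖ψ‖ = 1) :
    ‖inner ℂ φ ψ‖ ^ 2 ≤ (1 + ‖ψ ⬝ᵥ ψ‖) / 2 := by
  have hsum : ∑ j, star (φ j) * φ j = 1 := by
    have h1 : inner ℂ φ φ = 1 := inner_self_eq_one_of_norm_eq_one hφ
    rw [PiLp.inner_apply] at h1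
    simpa only [RCLike.inner_apply, mul_comm, RCLike.star_def] using h1
  set s : ℂ := φ ⬝ᵥ φ with hs
  have hc : ∀ i, φ i = s * star (φ i) := by
    intro i
    have h1 : ∀ j, φ i * star (φ j) = star (φ i) * φ j := by
      intro j
      have h2 := Complex.conj_eq_iff_im.mpr (hr i j)
      simp only [ketbra, Matrix.of_apply, map_mul] at h2
      rw [← h2]
      simp
    calc φ i = φ i * ∑ j, star (φ j) * φ j := by rw [hsum, mul_one]
      _ = ∑ j, φ i * star (φ j) * φ j := by rw [Finset.mul_sum]; simp only [mul_assoc]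
      _ = ∑ j, star (φ i) * φ j * φ j := by simp only [h1]
      _ = s * star (φ i) := by
        rw [hs, dotProduct, mul_comm, Finset.mul_sum]; simp only [mul_assoc]
  set z : ℂ := inner ℂ φ ψ with hz
  have hφψ : φ ⬝ᵥ ψ = s * z := by
    rw [hz, PiLp.inner_apply, dotProduct, Finset.mul_sum]
    refine Finset.sum_congr rfl fun i _ => ?_
    conv_lhs => rw [hc i]
    simp only [RCLike.inner_apply, RCLike.star_def]
    ring
  have hs1 : ‖s‖ = 1 := by
    have h1 : φ = s • conjVec φ := by
      ext i; simpa [conjVec] using hc i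
    have h2 := congrArg norm h1
    rw [norm_smul, norm_conjVec, hφ, mul_one] at h2
    exact h2.symm
  have h1 := norm_dotProduct_self_le (ψ - z • φ)
  have h2 : ⇑(ψ - z • φ) ⬝ᵥ ⇑(ψ - z • φ) = ψ ⬝ᵥ ψ - s * z ^ 2 := by
    have h3 : ⇑(ψ - z • φ) = ⇑ψ - z • ⇑φ := rfl
    rw [h3, sub_dotProduct, dotProduct_sub, dotProduct_sub, dotProduct_smul, smul_dotProduct,
      dotProduct_smul, smul_dotProduct, dotProduct_comm ψ φ, hφψ, ← hs]
    simp only [smul_eq_mul]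
    ring
  have h4 : ‖ψ - z • φ‖ ^ 2 = 1 - ‖z‖ ^ 2 := by
    rw [norm_sub_sq (𝕜 := ℂ), inner_smul_right, norm_smul, hφ, hψ, ← inner_conj_symm, ← hz,
      Complex.mul_conj, Complex.normSq_eq_norm_sq]
    simp only [RCLike.re_to_complex, Complex.ofReal_re]
    ring
  rw [h2, h4] at h1
  have h5 := norm_sub_norm_le (s * z ^ 2) (ψ ⬝ᵥ ψ)
  rw [norm_sub_rev, norm_mul, hs1, norm_pow] at h5
  linarith

/-- Choose a phase `c` making the bilinear square of `cψ` nonnegative; the normalized real part of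
`cψ` is the witness. -/
theorem exists_isReal_le_norm_inner_sq (ψ : EuclideanSpace ℂ n) (hψ : ‖ψ‖ = 1) :
    ∃ φ : EuclideanSpace ℂ n, ‖φ‖ = 1 ∧ IsReal (ketbra φ) ∧
      (1 + ‖ψ ⬝ᵥ ψ‖) / 2 ≤ ‖inner ℂ φ ψ‖ ^ 2 := by
  obtain ⟨c, hc, hct⟩ : ∃ c : ℂ, ‖c‖ = 1 ∧ c ^ 2 * (ψ ⬝ᵥ ψ) = ‖ψ ⬝ᵥ ψ‖ := by
    refine ⟨Complex.exp ((-(ψ ⬝ᵥ ψ).arg / 2 : ℝ) * Complex.I), Complex.norm_exp_ofReal_mul_I _, ?_⟩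
    have h := Complex.norm_mul_exp_arg_mul_I (ψ ⬝ᵥ ψ)
    generalize (ψ ⬝ᵥ ψ).arg = θ at h ⊢
    conv_lhs => rw [← h]
    rw [← Complex.exp_nat_mul, mul_left_comm, ← Complex.exp_add]
    push_cast
    rw [show 2 * (-(θ : ℂ) / 2 * Complex.I) + θ * Complex.I = 0 by ring,
      Complex.exp_zero, mul_one]
  let a : EuclideanSpace ℂ n := WithLp.toLp 2 fun i => ((c * ψ i).re : ℂ)
  -- Squared real and imaginary parts of `cψ` sum to `1` and differ by `|ψ ⬝ᵥ ψ|`.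
  have hsq : ‖a‖ ^ 2 = (1 + ‖ψ ⬝ᵥ ψ‖) / 2 := by
    have h1 : ∑ i, ((c * ψ i).re ^ 2 - (c * ψ i).im ^ 2) = ‖ψ ⬝ᵥ ψ‖ := by
      have := congrArg Complex.re hct
      rw [Complex.ofReal_re] at this
      rw [← this, dotProduct, Finset.mul_sum, Complex.re_sum]
      refine Finset.sum_congr rfl fun i _ => ?_
      rw [show c ^ 2 * (ψ i * ψ i) = (c * ψ i) * (c * ψ i) by ring, Complex.mul_re (c * ψ i)]
      ring
    have h2 : ∑ i, ((c * ψ i).re ^ 2 + (c * ψ i).im ^ 2) = 1 := by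
      have h3 : ‖c • ψ‖ ^ 2 = 1 := by rw [norm_smul, hc, hψ]; norm_num
      rw [EuclideanSpace.norm_sq_eq] at h3
      rw [← h3]
      refine Finset.sum_congr rfl fun i _ => ?_
      rw [← Complex.normSq_eq_norm_sq, Complex.normSq_apply]
      simp only [PiLp.smul_apply, smul_eq_mul]
      ring
    rw [EuclideanSpace.norm_sq_eq]
    simp only [a, Complex.norm_real, Real.norm_eq_abs, sq_abs]
    rw [← h1, ← h2, ← Finset.sum_add_distrib, Finset.sum_div]
    exact Finset.sum_congr rfl fun i _ => by ring
  have ha : 0 < ‖a‖ := by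
    have : 0 < ‖a‖ ^ 2 := by rw [hsq]; positivity
    exact (norm_nonneg a).lt_of_ne fun h => by simp [← h] at this
  refine ⟨((‖a‖⁻¹ : ℝ) : ℂ) • a, ?_, fun i j => ?_, ?_⟩
  · rw [norm_smul, Complex.norm_real, norm_inv, norm_norm, inv_mul_cancel₀ ha.ne']
  · simp [ketbra, a]
  · rw [← hsq]
    refine pow_le_pow_left₀ ha.le ?_ 2
    rw [inner_smul_left, norm_mul, RCLike.norm_conj, Complex.norm_real, norm_inv, norm_norm,
      le_inv_mul_iff₀ ha, ← sq]
    have h1 : ‖inner ℂ a (c • ψ)‖ = ‖inner ℂ a ψ‖ := by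
      rw [inner_smul_right, norm_mul, hc, one_mul]
    rw [← h1]
    refine le_trans (le_of_eq ?_) (Complex.re_le_norm _)
    rw [PiLp.inner_apply, Complex.re_sum, EuclideanSpace.norm_sq_eq]
    refine Finset.sum_congr rfl fun i _ => ?_
    have h2 : (c • ψ) i = c * ψ i := rfl
    rw [RCLike.inner_apply, h2, Complex.norm_real, Real.norm_eq_abs, sq_abs, Complex.conj_ofReal,
      Complex.re_mul_ofReal, sq]

/-- The factor `X` of `ρ = X Xᴴ` with columns `√p_j |ψ_j⟩`. -/
theorem IsPureDecomposition.exists_factor {m : Type} [Fintype m]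
    {ρ : Matrix n n ℂ} {p : m → ℝ} {ψ : m → EuclideanSpace ℂ n}
    (h : IsPureDecomposition ρ p ψ) :
    ∃ X : Matrix n m ℂ, X * Xᴴ = ρ ∧ ∀ j, ‖(Xᵀ * X) j j‖ = p j * ‖ψ j ⬝ᵥ ψ j‖ := by
  have hp (j : m) : ((√(p j) : ℝ) : ℂ) * (√(p j) : ℝ) = p j := by
    rw [← Complex.ofReal_mul, Real.mul_self_sqrt (h.nonneg j)]
  refine ⟨Matrix.of fun i j => (√(p j) : ℝ) * ψ j i, ?_, fun j => ?_⟩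
  · rw [h.eq_sum]
    ext i k
    rw [Matrix.mul_apply, Matrix.sum_apply]
    refine Finset.sum_congr rfl fun j _ => ?_
    simp only [Matrix.of_apply, Matrix.conjTranspose_apply, star_mul', RCLike.star_def,
      Complex.conj_ofReal, Matrix.smul_apply, ketbra, smul_eq_mul, ← hp]
    ring
  · have : ((Matrix.of fun i j => ((√(p j) : ℝ) : ℂ) * ψ j i)ᵀ *
        Matrix.of fun i j => ((√(p j) : ℝ) : ℂ) * ψ j i) j j = p j * (ψ j ⬝ᵥ ψ j) := by
      rw [Matrix.mul_apply, dotProduct, Finset.mul_sum]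
      refine Finset.sum_congr rfl fun i _ => ?_
      simp only [Matrix.of_apply, Matrix.transpose_apply, ← hp]
      ring
    rw [this, norm_mul, Complex.norm_real, Real.norm_of_nonneg (h.nonneg j)]

theorem pureGeomImaginarity_eq [DecidableEq n] (ψ : EuclideanSpace ℂ n) (hψ : ‖ψ‖ = 1) :
    pureGeomImaginarity ψ = (1 - ‖ψ ⬝ᵥ ψ‖) / 2 := by
  have hub : ∀ x ∈ realOverlaps ψ, x ≤ (1 + ‖ψ ⬝ᵥ ψ‖) / 2 := by
    rintro _ ⟨φ, hφ, hr, rfl⟩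
    exact norm_inner_sq_le_of_isReal φ ψ hφ hr hψ
  obtain ⟨φ, hφ, hr, hle⟩ := exists_isReal_le_norm_inner_sq ψ hψ
  have hsup : sSup (realOverlaps ψ) = (1 + ‖ψ ⬝ᵥ ψ‖) / 2 :=
    le_antisymm (csSup_le ⟨_, φ, hφ, hr, rfl⟩ hub)
      (hle.trans (le_csSup ⟨_, hub⟩ ⟨φ, hφ, hr, rfl⟩))
  rw [pureGeomImaginarity, hsup]
  ring

/-! ### Takagi factorization through antilinear eigenvectors -/

/-- An antilinear map with `⟪v, T w⟫ = ⟪w, T v⟫` on a nontrivial finite-dimensional invariant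
subspace has a unit eigenvector with nonnegative eigenvalue. -/
theorem exists_unit_eigenvector_of_antilinear {E : Type*} [NormedAddCommGroup E]
    [InnerProductSpace ℂ E] [FiniteDimensional ℂ E] (T : E →ₛₗ[starRingEnd ℂ] E)
    (hT : ∀ v w, inner ℂ v (T w) = inner ℂ w (T v)) (W : Submodule ℂ E) (hW : W ≠ ⊥)
    (hinv : ∀ w ∈ W, T w ∈ W) :
    ∃ v ∈ W, ‖v‖ = 1 ∧ ∃ s : ℝ, 0 ≤ s ∧ T v = (s : ℂ) • v := by
  suffices h : ∃ v ∈ W, v ≠ 0 ∧ ∃ s : ℝ, 0 ≤ s ∧ T v = (s : ℂ) • v by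
    obtain ⟨v, hv, hv0, s, hs, hTv⟩ := h
    refine ⟨((‖v‖⁻¹ : ℝ) : ℂ) • v, W.smul_mem _ hv, ?_, s, hs, ?_⟩
    · rw [norm_smul, Complex.norm_real, norm_inv, norm_norm,
        inv_mul_cancel₀ (norm_ne_zero_iff.mpr hv0)]
    · rw [map_smulₛₗ, hTv, Complex.conj_ofReal, smul_comm]
  have : Nontrivial W := Submodule.nontrivial_iff_ne_bot.mpr hW
  -- `T²` is linear, hence has an eigenvalue `c`; symmetry of `T` gives `c‖w‖² = ‖Tw‖²`, so `c =
  -- s²`.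
  let TW : W →ₗ[ℂ] W := (T.comp T).restrict fun w hw => hinv _ (hinv w hw)
  obtain ⟨c, hc⟩ := Module.End.exists_eigenvalue TW
  obtain ⟨w, hw⟩ := hc.exists_hasEigenvector
  have hTT : T (T w) = c • (w : E) := congrArg Subtype.val hw.apply_eq_smul
  have hw0 : (w : E) ≠ 0 := fun h => hw.2 (Subtype.ext h)
  have hn : ‖(w : E)‖ ≠ 0 := norm_ne_zero_iff.mpr hw0
  obtain ⟨s, hs, rfl⟩ : ∃ s : ℝ, 0 ≤ s ∧ c = (s : ℂ) * s := by
    refine ⟨‖T w‖ / ‖(w : E)‖, by positivity, ?_⟩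
    have h1 := hT w (T w)
    rw [hTT, inner_smul_right, inner_self_eq_norm_sq_to_K, inner_self_eq_norm_sq_to_K] at h1
    have hn' : (‖(w : E)‖ : ℂ) ≠ 0 := by exact_mod_cast hn
    simp only [Complex.coe_algebraMap] at h1
    push_cast
    field_simp
    exact h1
  -- If nonzero, `Tw + sw` is an eigenvector for `s`. Otherwise `Tw = -sw`, and antilinearity flips
  -- the sign on `iw`.
  by_cases h0 : T w + (s : ℂ) • (w : E) = 0
  · refine ⟨Complex.I • (w : E), W.smul_mem _ w.2, smul_ne_zero Complex.I_ne_zero hw0, s, hs, ?_⟩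
    rw [map_smulₛₗ, eq_neg_of_add_eq_zero_left h0, Complex.conj_I, neg_smul_neg, smul_comm]
  · refine ⟨_, W.add_mem (hinv _ w.2) (W.smul_mem _ w.2), h0, s, hs, ?_⟩
    rw [map_add, map_smulₛₗ, hTT, Complex.conj_ofReal, smul_add, smul_smul, add_comm]

/-- The orthogonal complement of the eigenvectors already found is `T`-invariant, by symmetry of
`T`, so it contains another one. -/
theorem exists_orthonormal_eigenvectors_of_antilinear {E : Type*} [NormedAddCommGroup E]
    [InnerProductSpace ℂ E] [FiniteDimensional ℂ E] (T : E →ₛₗ[starRingEnd ℂ] E)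
    (hT : ∀ v w, inner ℂ v (T w) = inner ℂ w (T v)) (k : ℕ) (hk : k ≤ Module.finrank ℂ E) :
    ∃ (v : Fin k → E) (s : Fin k → ℝ), Orthonormal ℂ v ∧ (∀ i, 0 ≤ s i) ∧
      ∀ i, T (v i) = (s i : ℂ) • v i := by
  induction k with
  | zero => exact ⟨Fin.elim0, Fin.elim0, ⟨fun i => i.elim0, fun i => i.elim0⟩,
      fun i => i.elim0, fun i => i.elim0⟩
  | succ k ih =>
    obtain ⟨v, s, hv, hs, hTv⟩ := ih (by omega)
    have hW : (Submodule.span ℂ (Set.range v))ᗮ ≠ ⊥ := by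
      intro h
      rw [Submodule.orthogonal_eq_bot_iff] at h
      have h1 := finrank_span_eq_card hv.linearIndependent
      rw [h, finrank_top, Fintype.card_fin] at h1
      omega
    have hmem : ∀ w, w ∈ (Submodule.span ℂ (Set.range v))ᗮ ↔ ∀ i, inner ℂ (v i) w = 0 := by
      intro w
      rw [Submodule.mem_orthogonal]
      refine ⟨fun h i => h _ (Submodule.subset_span ⟨i, rfl⟩), fun h u hu => ?_⟩
      induction hu using Submodule.span_induction with
      | mem x hx => obtain ⟨i, rfl⟩ := hx; exact h i
      | zero => exact inner_zero_left _
      | add x y _ _ hx hy => rw [inner_add_left, hx, hy, add_zero]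
      | smul a x _ hx => rw [inner_smul_left, hx, mul_zero]
    obtain ⟨w, hw, hw1, t, ht, hTw⟩ := exists_unit_eigenvector_of_antilinear T hT _ hW
      fun w hw => (hmem _).mpr fun i => by
        rw [hT, hTv, inner_smul_right, inner_eq_zero_symm.mp ((hmem w).mp hw i), mul_zero]
    rw [hmem] at hw
    refine ⟨Fin.snoc v w, Fin.snoc s t, ⟨fun i => ?_, fun i j hij => ?_⟩, fun i => ?_, fun i => ?_⟩
    · refine Fin.lastCases ?_ (fun i => ?_) i
      · simpa using hw1
      · simpa using hv.1 i
    · induction i using Fin.lastCases with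
      | last =>
        induction j using Fin.lastCases with
        | last => exact absurd rfl hij
        | cast j => simpa using inner_eq_zero_symm.mp (hw j)
      | cast i =>
        induction j using Fin.lastCases with
        | last => simpa using hw i
        | cast j => simpa using hv.2 fun h => hij (congrArg _ h)
    · refine Fin.lastCases ?_ (fun i => ?_) i
      · simpa using ht
      · simpa using hs i
    · refine Fin.lastCases ?_ (fun i => ?_) i
      · simpa using hTw
      · simpa using hTv i

variable [DecidableEq n]

/-- Autonne-Takagi factorization of a complex symmetric matrix. -/
theorem exists_unitary_transpose_mul_mul_eq_diagonal (K : Matrix n n ℂ) (hK : Kᵀ = K) :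
    ∃ (U : Matrix n n ℂ) (s : n → ℝ), Uᴴ * U = 1 ∧ (∀ i, 0 ≤ s i) ∧
      Uᵀ * K * U = Matrix.diagonal fun i => (s i : ℂ) := by
  -- For `T v = (K v)*`, the equation `T v = s v` with `s` real reads `K v = s v*`, so orthonormal
  -- eigenvectors diagonalize the bilinear form of `K`.
  let T : EuclideanSpace ℂ n →ₛₗ[starRingEnd ℂ] EuclideanSpace ℂ n :=
    { toFun := fun v => WithLp.toLp 2 (star (K *ᵥ v))
      map_add' := fun v w => by
        ext i; simp [Matrix.mulVec_add]
      map_smul' := fun c v => by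
        ext i; simp [Matrix.mulVec_smul] }
  have hT : ∀ v w, inner ℂ v (T w) = inner ℂ w (T v) := by
    intro v w
    simp only [T, LinearMap.coe_mk, AddHom.coe_mk, EuclideanSpace.inner_eq_star_dotProduct]
    rw [Matrix.star_dotProduct_star, Matrix.star_dotProduct_star, Matrix.dotProduct_mulVec,
      ← Matrix.mulVec_transpose, hK, dotProduct_comm]
  obtain ⟨v, s, hv, hs, hTv⟩ := exists_orthonormal_eigenvectors_of_antilinear T hT
    (Fintype.card n) (by simp)
  let e := Fintype.equivFin n
  refine ⟨Matrix.of fun i j => v (e j) i, s ∘ e, ?_, fun i => hs _, ?_⟩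
  · ext i j
    have := orthonormal_iff_ite.mp hv (e i) (e j)
    rw [EuclideanSpace.inner_eq_star_dotProduct] at this
    simp only [e.injective.eq_iff] at this
    rw [Matrix.one_apply, ← this, Matrix.mul_apply, dotProduct]
    simp [mul_comm]
  · ext i j
    have h1 : K *ᵥ v (e j) = (s (e j) : ℂ) • star ⇑(v (e j)) := by
      have := congrArg (fun u : EuclideanSpace ℂ n => star ⇑u) (hTv (e j))
      simpa [T, star_smul] using this
    have h2 := orthonormal_iff_ite.mp hv (e j) (e i)
    rw [EuclideanSpace.inner_eq_star_dotProduct] at h2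
    simp only [e.injective.eq_iff] at h2
    rw [Matrix.mul_mul_apply]
    change v (e i) ⬝ᵥ K *ᵥ v (e j) = _
    rw [h1, dotProduct_smul, h2, Matrix.diagonal_apply]
    by_cases hij : i = j <;> simp [hij, eq_comm]

theorem exists_equiv_of_map_univ_eq {α β : Type*} [Fintype α] (f g : α → β)
    (h : Finset.univ.val.map f = Finset.univ.val.map g) : ∃ e : α ≃ α, ∀ a, g (e a) = f a := by
  classical
  have hc (b : β) : Nonempty ({a // f a = b} ≃ {a // g a = b}) := by
    have := congrArg (Multiset.count b) h
    rw [Multiset.count_map, Multiset.count_map] at this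
    refine ⟨Fintype.equivOfCardEq ?_⟩
    rw [Fintype.card_subtype, Fintype.card_subtype]
    simpa [Finset.card_def, eq_comm] using this
  exact ⟨Equiv.ofFiberEquiv fun b => (hc b).some, Equiv.ofFiberEquiv_map _⟩

/-- The diagonal of the Autonne-Takagi factorization lists the eigenvalues of `H = √(Kᴴ K)`. -/
theorem exists_unitary_transpose_mul_mul_eq_diagonal_eigenvalues (K H : Matrix n n ℂ)
    (hK : Kᵀ = K) (hH : H.PosSemidef) (hHK : H * H = Kᴴ * K) :
    ∃ U : Matrix n n ℂ, Uᴴ * U = 1 ∧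
      Uᵀ * K * U = Matrix.diagonal fun i => (hH.isHermitian.eigenvalues i : ℂ) := by
  obtain ⟨U, s, hU, hs, hd⟩ := exists_unitary_transpose_mul_mul_eq_diagonal K hK
  have hU' : U * Uᴴ = 1 := mul_eq_one_comm.mp hU
  have hUt : Uᴴᵀ * Uᵀ = 1 := by rw [← Matrix.transpose_mul, hU', Matrix.transpose_one]
  have hUt' : Uᵀ * Uᴴᵀ = 1 := by rw [← Matrix.transpose_mul, hU, Matrix.transpose_one]
  set D : Matrix n n ℂ := Matrix.diagonal fun i => (s i : ℂ) with hD
  have hDH : Dᴴ = D := by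
    rw [hD, Matrix.diagonal_conjTranspose]; congr; ext i; simp
  have hKD : K = Uᴴᵀ * D * Uᴴ := by
    rw [← hd]
    calc K = (Uᴴᵀ * Uᵀ) * K * (U * Uᴴ) := by rw [hUt, hU', one_mul, mul_one]
      _ = _ := by simp only [mul_assoc]
  -- Both sides are positive square roots of `Kᴴ * K`.
  have hHD : H = U * D * Uᴴ := by
    have hp : (U * D * Uᴴ).PosSemidef :=
      (Matrix.PosSemidef.diagonal fun i => by simpa using hs i).mul_mul_conjTranspose_same U
    rw [← CFC.sqrt_unique hHK (Matrix.nonneg_iff_posSemidef.mpr hH)]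
    refine CFC.sqrt_unique ?_ (Matrix.nonneg_iff_posSemidef.mpr hp)
    rw [hKD]
    simp only [Matrix.conjTranspose_mul, Matrix.conjTranspose_conjTranspose, hDH]
    have h1 : Uᴴᵀᴴ = Uᵀ := by ext; simp
    rw [h1]
    calc U * D * Uᴴ * (U * D * Uᴴ) = U * D * (Uᴴ * U) * D * Uᴴ := by simp only [mul_assoc]
      _ = U * D * (Uᵀ * Uᴴᵀ) * D * Uᴴ := by rw [hU, hUt']
      _ = _ := by simp only [mul_assoc]
  have hroots : Finset.univ.val.map hH.isHermitian.eigenvalues = Finset.univ.val.map s := by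
    have h1 := hH.isHermitian.roots_charpoly_eq_eigenvalues
    have h2 : H.charpoly = D.charpoly := by
      rw [hHD, Matrix.charpoly_mul_comm, ← mul_assoc, hU, one_mul]
    rw [h2, hD, Matrix.charpoly_diagonal, Polynomial.roots_prod _ _
      (by simp [Finset.prod_ne_zero_iff, Polynomial.X_sub_C_ne_zero])] at h1
    have h3 := congrArg (Multiset.map Complex.re) h1
    simpa [Multiset.map_map, Function.comp_def] using h3.symm
  obtain ⟨e, he⟩ := exists_equiv_of_map_univ_eq _ _ hroots
  -- Permuting the columns of `U` puts the Takagi values in the prescribed order of the eigenvalues.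
  refine ⟨U.submatrix id e, ?_, ?_⟩
  · rw [Matrix.conjTranspose_submatrix, ← Matrix.submatrix_mul _ _ _ _ _ Function.bijective_id,
      hU, Matrix.submatrix_one_equiv]
  · have h1 : (U.submatrix id e)ᵀ * K * U.submatrix id e = (Uᵀ * K * U).submatrix e e := by
      rw [Matrix.submatrix_mul _ _ _ _ _ Function.bijective_id,
        Matrix.submatrix_mul _ _ _ _ _ Function.bijective_id, Matrix.submatrix_id_id,
        Matrix.transpose_submatrix]
    rw [h1, hd, hD, Matrix.submatrix_diagonal_equiv]
    congr 1
    ext i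
    simp [he]

/-! ### The upper bound over all factors -/

/-- A generalized inverse `S` of `√ρ`: it inverts `√ρ` on the columns of every factor `X` of `ρ`. -/
theorem exists_generalized_inverse_sqrt (ρ : Matrix n n ℂ) (hρ : ρ.PosSemidef) :
    ∃ S : Matrix n n ℂ, Sᴴ = S ∧ (1 - S * ρ * S).PosSemidef ∧
      ∀ {m : Type} [Fintype m] (X : Matrix n m ℂ), X * Xᴴ = ρ → CFC.sqrt ρ * S * X = X := by
  have hsa : IsSelfAdjoint ρ := hρ.isHermitian
  have hρ0 : 0 ≤ ρ := Matrix.nonneg_iff_posSemidef.mpr hρ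
  have hcont (f : ℝ → ℝ) : ContinuousOn f (spectrum ℝ ρ) :=
    (Matrix.finite_real_spectrum (A := ρ)).continuousOn f
  have hspec : ∀ x ∈ spectrum ℝ ρ, 0 ≤ x := fun x hx => spectrum_nonneg_of_nonneg hρ0 hx
  have hsqrt : CFC.sqrt ρ = cfc Real.sqrt ρ := by
    rw [CFC.sqrt_eq_real_sqrt ρ hρ0, cfcₙ_eq_cfc (hf := by fun_prop)]
  have hid : cfc (fun x : ℝ => x) ρ = ρ := cfc_id' ℝ ρ
  -- Since `0⁻¹ = 0`, `S` vanishes on the kernel of `ρ`, and `S * ρ * S` is the projection onto its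
  -- support.
  refine ⟨cfc (fun x : ℝ => (√x)⁻¹) ρ, cfc_predicate (fun x : ℝ => (√x)⁻¹) ρ, ?_, ?_⟩
  · rw [← Matrix.nonneg_iff_posSemidef, sub_nonneg]
    nth_rewrite 2 [← hid]
    rw [← cfc_mul _ _ ρ (hcont _) (hcont _), ← cfc_mul _ _ ρ (hcont _) (hcont _)]
    refine cfc_le_one _ _ fun x hx => ?_
    by_cases h0 : x = 0
    · simp [h0]
    · have hx0 : √x ≠ 0 := (Real.sqrt_pos.mpr ((hspec x hx).lt_of_ne' h0)).ne'
      apply le_of_eq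
      nth_rewrite 2 [← Real.mul_self_sqrt (hspec x hx)]
      field_simp
  · intro m _ X hX
    set E := cfc (fun x : ℝ => √x * (√x)⁻¹ - 1) ρ with hE
    have hE' : CFC.sqrt ρ * cfc (fun x : ℝ => (√x)⁻¹) ρ - 1 = E := by
      rw [hsqrt, ← cfc_mul _ _ ρ (hcont _) (hcont _), ← cfc_one ℝ ρ,
        ← cfc_sub _ _ ρ (hcont _) (hcont _)]
      rfl
    have hEρ : E * ρ = 0 := by
      nth_rewrite 1 [← hid]
      rw [hE, ← cfc_mul _ _ ρ (hcont _) (hcont _), ← cfc_zero ℝ ρ]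
      refine cfc_congr fun x hx => ?_
      by_cases h0 : x = 0
      · simp [h0]
      · have hx0 : √x ≠ 0 := (Real.sqrt_pos.mpr ((hspec x hx).lt_of_ne' h0)).ne'
        simp [hx0]
    -- `(E * X) * (E * X)ᴴ = E * ρ * Eᴴ = 0`.
    have hEX : E * X = 0 := by
      rw [← Matrix.self_mul_conjTranspose_eq_zero, Matrix.conjTranspose_mul, Matrix.mul_assoc,
        ← Matrix.mul_assoc X, hX, ← Matrix.mul_assoc, hEρ, Matrix.zero_mul]
    rw [← hE', Matrix.sub_mul, Matrix.one_mul, sub_eq_zero] at hEX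
    exact hEX

theorem sum_norm_diag_transpose_mul_self_le {m : Type} [Fintype m] (ρ : Matrix n n ℂ)
    (hρ : ρ.PosSemidef) (U : Matrix n n ℂ) (hU : Uᴴ * U = 1) (d : n → ℝ) (hd : ∀ i, 0 ≤ d i)
    (hUd : Uᵀ * ((CFC.sqrt ρ)ᵀ * CFC.sqrt ρ) * U = Matrix.diagonal fun i => (d i : ℂ))
    (X : Matrix n m ℂ) (hX : X * Xᴴ = ρ) :
    ∑ j, ‖(Xᵀ * X) j j‖ ≤ ∑ i, d i := by
  obtain ⟨S, hS, hSρ, hSX⟩ := exists_generalized_inverse_sqrt ρ hρ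
  have hU' : U * Uᴴ = 1 := mul_eq_one_comm.mp hU
  set R := CFC.sqrt ρ
  set V := Uᴴ * S * X with hV
  have hX' : X = R * U * V := by
    calc X = R * S * X := (hSX X hX).symm
      _ = R * (U * Uᴴ) * S * X := by rw [hU', Matrix.mul_one]
      _ = R * U * V := by rw [hV]; simp only [Matrix.mul_assoc]
  have hXX : Xᵀ * X = Vᵀ * (Matrix.diagonal fun i => (d i : ℂ)) * V := by
    rw [← hUd]
    conv_lhs => rw [hX']
    simp only [Matrix.transpose_mul, Matrix.mul_assoc]
  have hVV : V * Vᴴ = Uᴴ * (S * ρ * S) * U := by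
    rw [hV, ← hX]
    simp only [Matrix.conjTranspose_mul, Matrix.conjTranspose_conjTranspose, hS, Matrix.mul_assoc]
  -- The squared row norms are the diagonal of `V * Vᴴ = Uᴴ * (S * ρ * S) * U ≤ 1`.
  have hrow : ∀ i, ∑ j, ‖V i j‖ ^ 2 ≤ 1 := by
    intro i
    have h1 : (1 - V * Vᴴ).PosSemidef := by
      have := hSρ.conjTranspose_mul_mul_same U
      rwa [Matrix.mul_sub, Matrix.sub_mul, Matrix.mul_one, hU, ← hVV] at this
    have h2 : (V * Vᴴ) i i = ((∑ j, ‖V i j‖ ^ 2 : ℝ) : ℂ) := by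
      rw [Matrix.mul_apply]
      push_cast
      refine Finset.sum_congr rfl fun j _ => ?_
      rw [Matrix.conjTranspose_apply, RCLike.star_def, Complex.mul_conj']
    have h3 := h1.diag_nonneg (i := i)
    rw [Matrix.sub_apply, Matrix.one_apply_eq, h2, ← Complex.ofReal_one, ← Complex.ofReal_sub,
      Complex.zero_le_real, sub_nonneg] at h3
    exact h3
  calc ∑ j, ‖(Xᵀ * X) j j‖ ≤ ∑ j, ∑ i, d i * ‖V i j‖ ^ 2 := by
        refine Finset.sum_le_sum fun j _ => ?_
        rw [hXX, Matrix.mul_apply]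
        refine (norm_sum_le _ _).trans (Finset.sum_le_sum fun i _ => le_of_eq ?_)
        rw [Matrix.mul_diagonal, Matrix.transpose_apply, norm_mul, norm_mul, Complex.norm_real,
          Real.norm_of_nonneg (hd i)]
        ring
    _ = ∑ i, d i * ∑ j, ‖V i j‖ ^ 2 := by
        rw [Finset.sum_comm]; simp only [Finset.mul_sum]
    _ ≤ ∑ i, d i := Finset.sum_le_sum fun i _ => mul_le_of_le_one_right (hd i) (hrow i)

theorem IsPureDecomposition.sum_mul_pureGeomImaginarity {ι : Type*} [Fintype ι]
    {ρ : Matrix n n ℂ} {p : ι → ℝ} {ψ : ι → EuclideanSpace ℂ n}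
    (h : IsPureDecomposition ρ p ψ) :
    ∑ j, p j * pureGeomImaginarity (ψ j) = (1 - ∑ j, p j * ‖ψ j ⬝ᵥ ψ j‖) / 2 := by
  nth_rewrite 1 [← h.sum_eq_one]
  rw [← Finset.sum_sub_distrib, Finset.sum_div]
  refine Finset.sum_congr rfl fun j _ => ?_
  rw [pureGeomImaginarity_eq _ (h.norm_eq_one j)]
  ring

/-! ### The optimal decomposition and the fidelity -/

/-- The columns of a square factor of a state, normalized, form a pure-state decomposition. -/
theorem exists_isPureDecomposition_of_mul_conjTranspose_eq (ρ : Matrix n n ℂ) (hρ : IsState ρ)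
    (Y : Matrix n n ℂ) (hY : Y * Yᴴ = ρ) :
    ∃ (q : n → ℝ) (μ : n → EuclideanSpace ℂ n), IsPureDecomposition ρ q μ ∧
      ∀ i j, Y i j = (√(q j) : ℝ) * μ j i := by
  have hne : Nonempty n := by
    by_contra hn
    rw [not_nonempty_iff] at hn
    have := hρ.trace_eq_one
    simp at this
  let y : n → EuclideanSpace ℂ n := fun j => WithLp.toLp 2 (Y.col j)
  let u : EuclideanSpace ℂ n := EuclideanSpace.single hne.some 1
  -- A zero column has weight zero, so any unit vector serves there.
  let μ : n → EuclideanSpace ℂ n := fun j => if y j = 0 then u else ((‖y j‖⁻¹ : ℝ) : ℂ) • y j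
  have hμ (j : n) : y j = (‖y j‖ : ℂ) • μ j := by
    by_cases h : y j = 0
    · simp [h]
    · have h1 : (‖y j‖ : ℂ) ≠ 0 := by exact_mod_cast norm_ne_zero_iff.mpr h
      simp only [μ, if_neg h]
      rw [smul_smul, Complex.ofReal_inv, mul_inv_cancel₀ h1, one_smul]
  have hYμ (i j : n) : Y i j = (√(‖y j‖ ^ 2) : ℝ) * μ j i := by
    rw [Real.sqrt_sq (norm_nonneg _)]
    exact congrArg (fun v : EuclideanSpace ℂ n => v i) (hμ j)
  refine ⟨fun j => ‖y j‖ ^ 2, μ, ⟨fun j => by positivity, ?_, fun j => ?_, ?_⟩, hYμ⟩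
  · have h1 := hρ.trace_eq_one
    rw [← hY, Matrix.trace] at h1
    have h2 : ((∑ j, ‖y j‖ ^ 2 : ℝ) : ℂ) = 1 := by
      rw [← h1]
      simp only [EuclideanSpace.norm_sq_eq, Matrix.diag_apply, Matrix.mul_apply]
      rw [Finset.sum_comm]
      push_cast
      refine Finset.sum_congr rfl fun i _ => Finset.sum_congr rfl fun j _ => ?_
      rw [Matrix.conjTranspose_apply, RCLike.star_def, Complex.mul_conj']
      rfl
    exact_mod_cast h2
  · by_cases h : y j = 0
    · simp [μ, h, u]
    · simp only [μ, if_neg h]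
      rw [norm_smul, Complex.norm_real, norm_inv, norm_norm,
        inv_mul_cancel₀ (norm_ne_zero_iff.mpr h)]
  · rw [← hY]
    ext i k
    rw [Matrix.mul_apply, Matrix.sum_apply]
    refine Finset.sum_congr rfl fun j _ => ?_
    rw [Matrix.conjTranspose_apply, hYμ, hYμ, Real.sqrt_sq (norm_nonneg _)]
    simp only [star_mul', RCLike.star_def, Complex.conj_ofReal, Matrix.smul_apply, ketbra,
      smul_eq_mul, Matrix.of_apply]
    push_cast
    ring

/-- Identifies the fidelity operator as `√(Kᴴ * K)` for `K = Rᵀ * R`, so its eigenvalues are the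
Takagi values of `K`. -/
theorem fidelityOp_mul_self_transpose (ρ : Matrix n n ℂ) (hρ : ρ.PosSemidef) :
    fidelityOp ρ ρᵀ * fidelityOp ρ ρᵀ =
      ((CFC.sqrt ρ)ᵀ * CFC.sqrt ρ)ᴴ * ((CFC.sqrt ρ)ᵀ * CFC.sqrt ρ) := by
  have hR : (CFC.sqrt ρ)ᴴ = CFC.sqrt ρ :=
    (Matrix.nonneg_iff_posSemidef.mp (CFC.sqrt_nonneg ρ)).isHermitian
  have hRR : CFC.sqrt ρ * CFC.sqrt ρ = ρ :=
    CFC.sqrt_mul_sqrt_self ρ (Matrix.nonneg_iff_posSemidef.mpr hρ)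
  have hRt : (CFC.sqrt ρ)ᵀᴴ = (CFC.sqrt ρ)ᵀ := congrArg Matrix.transpose hR
  have hprod : CFC.sqrt ρ * ρᵀ * CFC.sqrt ρ =
      ((CFC.sqrt ρ)ᵀ * CFC.sqrt ρ)ᴴ * ((CFC.sqrt ρ)ᵀ * CFC.sqrt ρ) := by
    rw [Matrix.conjTranspose_mul, hR, hRt]
    nth_rewrite 2 [← hRR]
    rw [Matrix.transpose_mul]
    simp only [mul_assoc]
  rw [fidelityOp, hprod, CFC.sqrt_mul_sqrt_self _
    (Matrix.nonneg_iff_posSemidef.mpr (Matrix.posSemidef_conjTranspose_mul_self _))]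

theorem sqrt_fidelity (ρ σ : Matrix n n ℂ) :
    √(fidelity ρ σ) = ∑ i, (fidelityOp_isHermitian ρ σ).eigenvalues i := by
  have h : (fidelityOp ρ σ).trace.re = ∑ i, (fidelityOp_isHermitian ρ σ).eigenvalues i := by
    rw [(fidelityOp_isHermitian ρ σ).trace_eq_sum_eigenvalues]
    simp
  rw [fidelity, h, Real.sqrt_sq]
  exact Finset.sum_nonneg fun i _ => (fidelityOp_posSemidef ρ σ).eigenvalues_nonneg i

end Imaginarity

open Imaginarity in
theorem mainTheorem3 {n : Type*} [Fintype n] [DecidableEq n] (ρ : Matrix n n ℂ)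
    (hρ : Imaginarity.IsState ρ) :
    -- the minimum over pure-state decompositions is attained
    IsLeast (Imaginarity.averageImaginarities ρ) (Imaginarity.geomImaginarity ρ) ∧
    Imaginarity.geomImaginarity ρ = (1 - √(Imaginarity.fidelity ρ ρᵀ)) / 2 ∧
    -- an optimal decomposition can be chosen conjugate-orthogonal
    ∃ (q : n → ℝ) (μ : n → EuclideanSpace ℂ n),
      Imaginarity.IsPureDecomposition ρ q μ ∧
      (∀ i j, (√(q i * q j) : ℂ) * inner ℂ (μ i) (Imaginarity.conjVec (μ j)) =
        if i = j then ((Imaginarity.fidelityOp_isHermitian ρ ρᵀ).eigenvalues j : ℂ) else 0) ∧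
      ∑ j, q j * Imaginarity.pureGeomImaginarity (μ j) = Imaginarity.geomImaginarity ρ := by
  set d := (fidelityOp_isHermitian ρ ρᵀ).eigenvalues with hd
  have hd0 : ∀ i, 0 ≤ d i := (fidelityOp_posSemidef ρ ρᵀ).eigenvalues_nonneg
  set R := CFC.sqrt ρ with hR
  have hRH : Rᴴ = R := (Matrix.nonneg_iff_posSemidef.mp (CFC.sqrt_nonneg ρ)).isHermitian
  obtain ⟨U, hU, hUd⟩ := exists_unitary_transpose_mul_mul_eq_diagonal_eigenvalues (Rᵀ * R) _
    (by rw [Matrix.transpose_mul, Matrix.transpose_transpose])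
    (fidelityOp_posSemidef ρ ρᵀ) (fidelityOp_mul_self_transpose ρ hρ.posSemidef)
  have hY : (R * U) * (R * U)ᴴ = ρ := by
    rw [Matrix.conjTranspose_mul, hRH, mul_assoc, ← mul_assoc U, mul_eq_one_comm.mp hU, one_mul]
    exact CFC.sqrt_mul_sqrt_self ρ (Matrix.nonneg_iff_posSemidef.mpr hρ.posSemidef)
  obtain ⟨q, μ, hdec, hYμ⟩ := exists_isPureDecomposition_of_mul_conjTranspose_eq ρ hρ _ hY
  have horth : ∀ i j, ((√(q i) : ℝ) : ℂ) * (√(q j) : ℝ) * (μ i ⬝ᵥ μ j) =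
      if i = j then (d j : ℂ) else 0 := by
    intro i j
    have h1 : (R * U)ᵀ * (R * U) = Matrix.diagonal fun i => (d i : ℂ) := by
      rw [hd, ← hUd, Matrix.transpose_mul]
      simp only [mul_assoc]
    have h2 := congrFun (congrFun h1 i) j
    rw [Matrix.mul_apply, Matrix.diagonal_apply] at h2
    simp only [Matrix.transpose_apply, hYμ] at h2
    have h3 : (if i = j then (d j : ℂ) else 0) = if i = j then (d i : ℂ) else 0 := by
      split_ifs with h
      · rw [h]
      · rfl
    rw [h3, ← h2, dotProduct, Finset.mul_sum]
    exact Finset.sum_congr rfl fun k _ => by ring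
  have hval : ∑ j, q j * pureGeomImaginarity (μ j) = (1 - √(fidelity ρ ρᵀ)) / 2 := by
    rw [hdec.sum_mul_pureGeomImaginarity, sqrt_fidelity]
    congr 2
    refine Finset.sum_congr rfl fun j _ => ?_
    have h1 := congrArg norm (horth j j)
    rw [if_pos rfl, ← Complex.ofReal_mul, Real.mul_self_sqrt (hdec.nonneg j), norm_mul,
      Complex.norm_real, Complex.norm_real, Real.norm_of_nonneg (hdec.nonneg j),
      Real.norm_of_nonneg (hd0 j)] at h1
    exact h1
  have hleast : IsLeast (averageImaginarities ρ) ((1 - √(fidelity ρ ρᵀ)) / 2) := by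
    constructor
    · let e := (Fintype.equivFin n).symm
      refine ⟨Fintype.card n, q ∘ e, μ ∘ e, ⟨fun j => hdec.nonneg _, ?_,
        fun j => hdec.norm_eq_one _, ?_⟩, ?_⟩
      · rw [← hdec.sum_eq_one]
        exact e.sum_comp q
      · rw [hdec.eq_sum]
        exact (e.sum_comp fun j => (q j : ℂ) • ketbra (μ j)).symm
      · rw [← hval]
        exact (e.sum_comp fun j => q j * pureGeomImaginarity (μ j)).symm
    · rintro _ ⟨m, p, ψ, hp, rfl⟩
      obtain ⟨X, hX, hXψ⟩ := hp.exists_factor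
      have h1 := sum_norm_diag_transpose_mul_self_le ρ hρ.posSemidef U hU d hd0 hUd X hX
      rw [hp.sum_mul_pureGeomImaginarity, sqrt_fidelity]
      simp only [hXψ] at h1
      linarith
  have hgeom : geomImaginarity ρ = (1 - √(fidelity ρ ρᵀ)) / 2 := hleast.csInf_eq
  refine ⟨hgeom ▸ hleast, hgeom, q, μ, hdec, fun i j => ?_, hval.trans hgeom.symm⟩
  -- The required overlap is the conjugate of the bilinear product; as `d` is real, `horth` survives
  -- conjugation.
  have h1 : inner ℂ (μ i) (conjVec (μ j)) = star (μ i ⬝ᵥ μ j) := by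
    rw [← inner_conj_symm, inner_conjVec_left, dotProduct_comm]
    rfl
  have h2 := congrArg star (horth i j)
  rw [star_mul', ← h1, star_mul'] at h2
  simp only [RCLike.star_def, Complex.conj_ofReal] at h2
  rw [Real.sqrt_mul (hdec.nonneg i), Complex.ofReal_mul, h2]
  split_ifs <;> simp
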